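/- Let $X=(X_t)_{t\ge 0}$ be a spectrally negative Lévy process with $X_0=0$ a.s. on a probability space $(\Omega,\mathcal F,\mathbb P)$; that is, $X$ has stationary and independent increments, its paths are a.s. càdlàg without positive jumps, and $-X$ is not a subordinator (the paths of $X$ are not a.s. nonincreasing). Let $\psi(s)=\log \mathbb E[e^{sX_1}]$, $s\ge 0$, be its Laplace exponent, and for $y\in\mathbb R$ let $T_y^+=\inf\{t>0 : X_t\ge y\}$, with $\inf\varnothing=\infty$. Let $\alpha\in\mathbb R$ (a possibly negative discount rate) be such that either (i) $\psi(1)<\alpha$, or (ii) $\psi(1)=\alpha<0$ and $\psi'(1)<0$. Then the set $\{s\ge 1:\psi(s)=\alpha\}$ has a largest element $\Phi(\alpha)=\sup\{s\ge 1:\psi(s)=\alpha\}$, and for every $y\in\mathbb R$ the random variable $e^{-\alpha T_y^+}\mathbf 1_{\{T_y^+<\infty\}}$ is integrable, with $$\mathbb E\big[e^{-\alpha T_y^+}\mathbf 1_{\{T_y^+<\infty\}}\big]=\begin{cases} e^{-\Phi(\alpha)y}, & y>0,\\ 1, & y\le 0.\end{cases}$$ -/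

import Mathlib

open MeasureTheory ProbabilityTheory Filter Topology
open scoped NNReal ENNReal

/-- A path `f : [0, ∞) → ℝ` is càdlàg: right-continuous, with (finite) left limits. -/
structure IsCadlagPath (f : ℝ≥0 → ℝ) : Prop where
  right_continuous : ∀ t : ℝ≥0, Tendsto f (𝓝[>] t) (𝓝 (f t))
  left_limit : ∀ t : ℝ≥0, 0 < t → ∃ l : ℝ, Tendsto f (𝓝[<] t) (𝓝 l)

/-- A path has no positive jumps: `f t ≤ f (t-)` for every `t > 0`. -/
def NoPositiveJumps (f : ℝ≥0 → ℝ) : Prop :=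
  ∀ t : ℝ≥0, 0 < t → ∀ l : ℝ, Tendsto f (𝓝[<] t) (𝓝 l) → f t ≤ l

/-- A real-valued Lévy process started at `0`: a process with almost surely càdlàg paths and
with stationary and independent increments. -/
structure IsLevyProcess {Ω : Type*} [MeasurableSpace Ω] (X : ℝ≥0 → Ω → ℝ) (P : Measure Ω) :
    Prop where
  measurable : ∀ t, Measurable (X t)
  start_zero : ∀ᵐ ω ∂P, X 0 ω = 0
  cadlag : ∀ᵐ ω ∂P, IsCadlagPath (fun t => X t ω)
  indep_increments : HasIndepIncrements X P
  stationary_increments : ∀ s t : ℝ≥0,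
    IdentDistrib (fun ω => X (s + t) ω - X s ω) (X t) P P

/-- A spectrally negative Lévy process: a Lévy process without positive jumps whose negative
is not a subordinator, i.e. whose paths are not almost surely nonincreasing. -/
structure IsSpectrallyNegativeLevy {Ω : Type*} [MeasurableSpace Ω] (X : ℝ≥0 → Ω → ℝ)
    (P : Measure Ω) : Prop extends IsLevyProcess X P where
  no_positive_jumps : ∀ᵐ ω ∂P, NoPositiveJumps (fun t => X t ω)
  not_neg_subordinator : ¬ ∀ᵐ ω ∂P, Antitone (fun t => X t ω)

/-- The Laplace exponent `ψ(s) = log E[exp (s X₁)]`. -/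
noncomputable def laplaceExponent {Ω : Type*} [MeasurableSpace Ω] (X : ℝ≥0 → Ω → ℝ)
    (P : Measure Ω) (s : ℝ) : ℝ :=
  Real.log (∫ ω, Real.exp (s * X 1 ω) ∂P)

/-- `Φ(α) = sup {s ≥ 1 : ψ(s) = α}`. -/
noncomputable def rightInverse {Ω : Type*} [MeasurableSpace Ω] (X : ℝ≥0 → Ω → ℝ)
    (P : Measure Ω) (α : ℝ) : ℝ :=
  sSup {s : ℝ | 1 ≤ s ∧ laplaceExponent X P s = α}

/-- The up-crossing time `T_y⁺ = inf {t > 0 : X_t ≥ y}`, with `inf ∅ = ∞`. -/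
noncomputable def upCrossingTime {Ω : Type*} (X : ℝ≥0 → Ω → ℝ) (y : ℝ) (ω : Ω) : ℝ≥0∞ :=
  sInf ((fun t : ℝ≥0 => (t : ℝ≥0∞)) '' {t : ℝ≥0 | 0 < t ∧ y ≤ X t ω})

/-- The discounted payoff `exp (-α T_y⁺) 1_{T_y⁺ < ∞}`. -/
noncomputable def discountedCrossing {Ω : Type*} (X : ℝ≥0 → Ω → ℝ) (α y : ℝ) : Ω → ℝ :=
  Set.indicator {ω | upCrossingTime X y ω < ∞}
    (fun ω => Real.exp (-α * (upCrossingTime X y ω).toReal))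

/-!
The proof rests on the exponential martingale `exp (s X_t - ψ(s) t)`.

**Optional stopping.** Let `T` be the time of passing strictly above a level `y ≥ 0`. Since `X` has
no positive jumps, it sits exactly at `y` at time `T`. Stopping the martingale with exponent
`θ = Φ(α)`, for which `ψ(θ) = α`, at `T ∧ N` therefore gives
`1 = E[exp (θ y - α T); T < N] + E[exp (θ X_N - α N); N ≤ T]`
(`lintegral_exp_strictCrossingTime_min`). Either hypothesis on `α` provides some `s₀ ≥ 1` with
`ψ(s₀) < α`, and `s₀ < θ`. On `{N ≤ T}` the process is below `y`, so that
`θ X_N ≤ (θ - s₀) y + s₀ X_N`, and the second term is at most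
`exp ((θ - s₀) y + (ψ(s₀) - α) N)`, which vanishes as `N → ∞`. This argument does not depend on
the sign of `α` and yields `E[exp (-α T); T < ∞] = exp (-θ y)`
(`lintegral_discount_strictCrossingTime`). Only optional stopping for random walks is needed: the
process is sampled on the grids `2⁻ⁿ ℕ`, and the limit `n → ∞` is justified by second moments,
bounded through the same identity with exponent `2 θ`.

**First passage above versus hitting `[y, ∞)`.** The transform is continuous in `y ≥ 0`. At a large
discount rate this squeezes the hitting time of `[y, ∞)` between strict crossing times and shows
that it equals `T` almost surely for `y > 0` (`upCrossingTime_ae_eq`); at `y = 0` the transform is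
`1`, so that the crossing time vanishes almost surely (`upCrossingTime_ae_eq_zero`).

**Exponential moments and the right inverse.** Finiteness of `E[exp (s X_1)]` has to be derived from
the absence of positive jumps. Over a short time interval the path stays below `1` with probability
close to `1`; the walks obtained from ever finer grids by truncating the steps at `1` eventually
agree with `X`, and optional stopping at level `1` bounds their exponential moments uniformly
(`expMoment_one_ne_top`). Then `ψ` is continuous on `[1, ∞)`, and it tends to `∞` because
`P(X_1 > 0) > 0` unless the paths are nonincreasing, so `Φ(α)` is found by the intermediate value
theorem (`isGreatest_rightInverse`).
-/

/-! ### Optional stopping for exponential functionals of random walks -/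

section

open Classical in
/-- The first index `j < k` at which the sequence `u` exceeds the level `y`, and `k` if there is
no such index. -/
noncomputable def exitIndex (u : ℕ → ℝ) (y : ℝ) : ℕ → ℕ
  | 0 => 0
  | k + 1 => if ∀ j ≤ k, u j ≤ y then k + 1 else exitIndex u y k

lemma exitIndex_le (u : ℕ → ℝ) (y : ℝ) (k : ℕ) : exitIndex u y k ≤ k := by
  induction k with
  | zero => simp [exitIndex]
  | succ k ih => unfold exitIndex; split_ifs <;> omega

lemma exitIndex_eq_self {u : ℕ → ℝ} {y : ℝ} {k : ℕ} (h : ∀ j < k, u j ≤ y) :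
    exitIndex u y k = k := by
  cases k with
  | zero => rfl
  | succ k => exact if_pos fun j hj => h j (by omega)

lemma le_of_lt_exitIndex {u : ℕ → ℝ} {y : ℝ} {k j : ℕ} (h : j < exitIndex u y k) : u j ≤ y := by
  induction k with
  | zero => simp [exitIndex] at h
  | succ k ih =>
    unfold exitIndex at h
    split_ifs at h with hk
    · exact hk j (by omega)
    · exact ih h

lemma lt_apply_exitIndex {u : ℕ → ℝ} {y : ℝ} {k : ℕ} (h : exitIndex u y k < k) :
    y < u (exitIndex u y k) := by
  induction k with
  | zero => omega
  | succ k ih =>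
    unfold exitIndex at h ⊢
    split_ifs at h ⊢ with hk
    · omega
    · by_cases hlt : exitIndex u y k < k
      · exact ih hlt
      · push Not at hk
        obtain ⟨j, hj, hy⟩ := hk
        have hkk : exitIndex u y k = k := le_antisymm (exitIndex_le _ _ _) (by omega)
        rcases hj.lt_or_eq with hj | rfl
        · exact absurd (le_of_lt_exitIndex (k := k) (by omega)) (not_le.2 hy)
        · rwa [hkk]

variable {Ω : Type*} [MeasurableSpace Ω] {P : Measure Ω}

lemma measurable_apply_exitIndex {E : Type*} [MeasurableSpace E] {u : ℕ → Ω → ℝ}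
    (hu : ∀ n, Measurable (u n)) {W : ℕ → Ω → E} (hW : ∀ n, Measurable (W n)) (y : ℝ) (k : ℕ) :
    Measurable fun ω => W (exitIndex (fun n => u n ω) y k) ω := by
  classical
  induction k with
  | zero => exact hW 0
  | succ k ih =>
    have hB : MeasurableSet {ω | ∀ j ≤ k, u j ω ≤ y} := by
      simp only [Set.ofPred_forall]
      exact .iInter fun j => .iInter fun _ => measurableSet_le (hu j) measurable_const
    have : (fun ω => W (exitIndex (fun n => u n ω) y (k + 1)) ω) = fun ω =>
        if ω ∈ {ω | ∀ j ≤ k, u j ω ≤ y} then W (k + 1) ω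
        else W (exitIndex (fun n => u n ω) y k) ω := by
      funext ω
      simp only [exitIndex]
      by_cases h : ∀ j ≤ k, u j ω ≤ y
      · rw [if_pos h, if_pos (show ω ∈ {ω | ∀ j ≤ k, u j ω ≤ y} from h)]
      · rw [if_neg h, if_neg (show ω ∉ {ω | ∀ j ≤ k, u j ω ≤ y} from h)]
    rw [this]
    exact Measurable.ite hB (hW _) ih

/-- The σ-algebra generated by the steps `ξ 0, …, ξ (k - 1)`. -/
@[reducible] def stepPast {Ω : Type*} (ξ : ℕ → Ω → ℝ) (k : ℕ) : MeasurableSpace Ω :=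
  ⨆ i ∈ Set.Iio k, MeasurableSpace.comap (ξ i) inferInstance

lemma stepPast_le {ξ : ℕ → Ω → ℝ} (hξ : ∀ n, Measurable (ξ n)) (k : ℕ) :
    stepPast ξ k ≤ ‹MeasurableSpace Ω› :=
  iSup₂_le fun i _ => (hξ i).comap_le

lemma measurable_stepPast {Ω : Type*} (ξ : ℕ → Ω → ℝ) {i k : ℕ} (hi : i < k) :
    Measurable[stepPast ξ k] (ξ i) :=
  measurable_iff_comap_le.2 (le_iSup₂_of_le (f := fun i (_ : i ∈ Set.Iio k) =>
    MeasurableSpace.comap (ξ i) inferInstance) i hi le_rfl)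

/-- Optional stopping for the exponential martingale of a random walk `S` with independent steps,
stopped at its first passage above `y` or at the time `k`, whichever is earlier. -/
lemma lintegral_exp_stopped_walk [IsProbabilityMeasure P] {ξ : ℕ → Ω → ℝ}
    (hξ : ∀ n, Measurable (ξ n)) (hind : iIndepFun ξ P) {s a : ℝ} (ha : 0 < a)
    (hexp : ∀ n, ∫⁻ ω, ENNReal.ofReal (Real.exp (s * ξ n ω)) ∂P = ENNReal.ofReal a)
    (S : ℕ → Ω → ℝ) (hS : ∀ n ω, S n ω = ∑ i ∈ Finset.range n, ξ i ω) (y : ℝ) (k : ℕ) :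
    ∫⁻ ω, ENNReal.ofReal (Real.exp (s * S (exitIndex (fun n => S n ω) y k) ω) /
      a ^ exitIndex (fun n => S n ω) y k) ∂P = 1 := by
  classical
  set W : ℕ → Ω → ℝ≥0∞ := fun n ω => ENNReal.ofReal (Real.exp (s * S n ω) / a ^ n) with hWdef
  set ρ : ℕ → Ω → ℝ≥0∞ := fun n ω => ENNReal.ofReal (Real.exp (s * ξ n ω) / a) with hρdef
  have hSm : ∀ n, Measurable (S n) := fun n => by
    rw [show S n = fun ω => ∑ i ∈ Finset.range n, ξ i ω from funext (hS n)]
    exact Finset.measurable_sum _ fun i _ => hξ i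
  have hWm : ∀ n, Measurable (W n) := fun n => by have := hSm n; fun_prop
  have hρ : ∀ n, ∫⁻ ω, ρ n ω ∂P = 1 := fun n => by
    simp only [hρdef, div_eq_mul_inv]
    simp_rw [ENNReal.ofReal_mul (Real.exp_pos _).le]
    rw [lintegral_mul_const _ (by have := hξ n; fun_prop), hexp, ← ENNReal.ofReal_mul ha.le,
      mul_inv_cancel₀ ha.ne', ENNReal.ofReal_one]
  have hstep : ∀ n ω, W (n + 1) ω = W n ω * ρ n ω := fun n ω => by
    simp only [hWdef, hρdef]
    rw [← ENNReal.ofReal_mul (by positivity), hS, hS, Finset.sum_range_succ, mul_add, Real.exp_add,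
      pow_succ, div_mul_div_comm]
  change ∫⁻ ω, W (exitIndex (fun n => S n ω) y k) ω ∂P = 1
  induction k with
  | zero => simp [exitIndex, hWdef, hS]
  | succ k ih =>
    set B : Set Ω := {ω | ∀ j ≤ k, S j ω ≤ y} with hBdef
    have hmle := stepPast_le hξ k
    have hSmm : ∀ j ≤ k, Measurable[stepPast ξ k] (S j) := fun j hj => by
      rw [show S j = fun ω => ∑ i ∈ Finset.range j, ξ i ω from funext (hS j)]
      exact Finset.measurable_sum _ fun i hi =>
        measurable_stepPast ξ ((Finset.mem_range.1 hi).trans_le hj)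
    have hBm : MeasurableSet[stepPast ξ k] B := by
      rw [hBdef]; simp only [Set.ofPred_forall]
      exact .iInter fun j => .iInter fun hj => hSmm j hj measurableSet_Iic
    have hWmm : Measurable[stepPast ξ k] (W k) := by
      have h : Measurable fun x : ℝ => ENNReal.ofReal (Real.exp (s * x) / a ^ k) := by fun_prop
      exact h.comp (hSmm k le_rfl)
    have hi : Indep (stepPast ξ k) (MeasurableSpace.comap (ξ k) inferInstance) P := by
      have := indep_iSup_of_disjoint (fun i => (hξ i).comap_le) hind
        (S := Set.Iio k) (T := {k}) (by simp)
      simpa [stepPast] using this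
    have hρm : Measurable[MeasurableSpace.comap (ξ k) inferInstance] (ρ k) := by
      have h : Measurable fun x : ℝ => ENNReal.ofReal (Real.exp (s * x) / a) := by fun_prop
      exact h.comp (comap_measurable (ξ k))
    have key := lintegral_mul_eq_lintegral_mul_lintegral_of_independent_measurableSpace hmle
      (hξ k).comap_le hi (hWmm.indicator hBm) hρm
    rw [hρ, mul_one] at key
    rw [← ih, ← lintegral_add_compl _ (hmle _ hBm),
      ← lintegral_add_compl (fun ω => W (exitIndex (fun n => S n ω) y k) ω) (hmle _ hBm)]
    congr 1
    · rw [← lintegral_indicator (hmle _ hBm), ← lintegral_indicator (hmle _ hBm)]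
      refine Eq.trans (lintegral_congr fun ω => ?_) (key.trans (lintegral_congr fun ω => ?_))
      · by_cases hω : ω ∈ B
        · simp only [Set.indicator_of_mem hω]
          rw [exitIndex_eq_self fun j hj => hω j (by omega), hstep]
        · simp [Set.indicator_of_notMem hω]
      · by_cases hω : ω ∈ B
        · simp only [Set.indicator_of_mem hω]
          rw [exitIndex_eq_self fun j hj => hω j (by omega)]
        · simp [Set.indicator_of_notMem hω]
    · refine setLIntegral_congr_fun (hmle _ hBm).compl fun ω hω => ?_
      have : ¬ ∀ j ≤ k, S j ω ≤ y := hω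
      simp only [exitIndex, if_neg this]

end

/-! ### Càdlàg paths without positive jumps -/

lemma IsCadlagPath.tendsto_nhdsGE {f : ℝ≥0 → ℝ} (hf : IsCadlagPath f) (t : ℝ≥0) :
    Tendsto f (𝓝[≥] t) (𝓝 (f t)) :=
  continuousWithinAt_Ioi_iff_Ici.1 (hf.right_continuous t)

/-- Without positive jumps, a càdlàg path that stays below `y` on `[0, t)` stays below `y` at
time `t`. -/
lemma NoPositiveJumps.le_of_forall_lt {f : ℝ≥0 → ℝ} (hf : IsCadlagPath f)
    (hj : NoPositiveJumps f) {t : ℝ≥0} (ht : 0 < t) {y : ℝ} (h : ∀ u < t, f u ≤ y) : f t ≤ y := by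
  obtain ⟨l, hl⟩ := hf.left_limit t ht
  have : (𝓝[<] t).NeBot := nhdsLT_neBot_of_exists_lt ⟨0, ht⟩
  exact (hj t ht l hl).trans
    (le_of_tendsto hl (eventually_nhdsWithin_of_forall fun u hu => h u hu))

/-- On a compact time interval, a càdlàg path without positive jumps increases by at most `ε`
over every sufficiently short interval. -/
lemma NoPositiveJumps.exists_forall_sub_le {f : ℝ≥0 → ℝ} (hf : IsCadlagPath f)
    (hj : NoPositiveJumps f) (t : ℝ≥0) {ε : ℝ} (hε : 0 < ε) :
    ∃ δ : ℝ, 0 < δ ∧ ∀ v w : ℝ≥0, v ≤ w → w ≤ t → (w : ℝ) - v < δ → f w - f v ≤ ε := by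
  have hloc : ∀ u : ℝ≥0, ∃ c : Set ℝ≥0, IsOpen c ∧ u ∈ c ∧
      ∀ v ∈ c, ∀ w ∈ c, v ≤ w → f w - f v ≤ ε := by
    intro u
    have hr : ∀ᶠ v in 𝓝[≥] u, dist (f v) (f u) < ε / 2 :=
      hf.tendsto_nhdsGE u (Metric.ball_mem_nhds _ (by positivity))
    have hl : ∃ l : ℝ, f u ≤ l ∧ ∀ᶠ v in 𝓝[<] u, dist (f v) l < ε / 2 := by
      rcases eq_or_ne u 0 with rfl | hu
      · exact ⟨f 0, le_rfl,
          eventually_nhdsWithin_of_forall fun v hv => absurd (Set.mem_Iio.1 hv) not_lt_zero⟩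
      · obtain ⟨l, hl⟩ := hf.left_limit u (pos_iff_ne_zero.2 hu)
        exact ⟨l, hj u (pos_iff_ne_zero.2 hu) l hl, hl (Metric.ball_mem_nhds _ (by positivity))⟩
    obtain ⟨l, hul, hl⟩ := hl
    rw [eventually_nhdsWithin_iff] at hr hl
    obtain ⟨c, hc, hco, huc⟩ := eventually_nhds_iff.1 (hr.and hl)
    refine ⟨c, hco, huc, fun v hv w hw hvw => ?_⟩
    have hv' := hc v hv
    have hw' := hc w hw
    simp only [Set.mem_Ici, Set.mem_Iio, Real.dist_eq, abs_lt] at hv' hw'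
    rcases lt_or_ge v u with h1 | h1 <;> rcases lt_or_ge w u with h2 | h2
    · linarith [hv'.2 h1, hw'.2 h2]
    · linarith [hv'.2 h1, hw'.1 h2]
    · exact absurd (hvw.trans_lt h2) (not_lt.2 h1)
    · linarith [hv'.1 h1, hw'.1 h2]
  choose c hco huc hc using hloc
  obtain ⟨δ, hδ, h⟩ := lebesgue_number_lemma_of_metric (isCompact_Icc (a := (0 : ℝ≥0)) (b := t))
    hco fun u _ => Set.mem_iUnion.2 ⟨u, huc u⟩
  refine ⟨δ, hδ, fun v w hvw hw hd => ?_⟩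
  obtain ⟨i, hi⟩ := h w ⟨zero_le, hw⟩
  refine hc i v (hi ?_) w (hi (Metric.mem_ball_self hδ)) hvw
  rw [Metric.mem_ball, NNReal.dist_eq, abs_sub_comm, abs_of_nonneg]
  · exact hd
  · exact sub_nonneg.2 (by exact_mod_cast hvw)

/-! ### Crossing times along the dyadic times -/

/-- The infimum of the dyadic times at which the path `f` lies strictly above the level `y`. For a
right-continuous path this is the first time of passing strictly above `y`; restricting to a
countable set of times makes measurability evident. -/
noncomputable def strictCrossingTime (f : ℝ≥0 → ℝ) (y : ℝ) : ℝ≥0∞ :=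
  ⨅ p : ℕ × ℕ, ⨅ _ : y < f (p.1 / 2 ^ p.2), ((p.1 / 2 ^ p.2 : ℝ≥0) : ℝ≥0∞)

lemma strictCrossingTime_le {f : ℝ≥0 → ℝ} {y : ℝ} (k n : ℕ) (h : y < f (k / 2 ^ n)) :
    strictCrossingTime f y ≤ ((k / 2 ^ n : ℝ≥0) : ℝ≥0∞) :=
  iInf₂_le (ι := ℕ × ℕ) (k, n) h

lemma strictCrossingTime_lt_iff {f : ℝ≥0 → ℝ} {y : ℝ} {c : ℝ≥0∞} :
    strictCrossingTime f y < c ↔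
      ∃ k n : ℕ, y < f (k / 2 ^ n) ∧ ((k / 2 ^ n : ℝ≥0) : ℝ≥0∞) < c := by
  simp [strictCrossingTime, iInf_lt_iff]

lemma measurable_strictCrossingTime {Ω : Type*} [MeasurableSpace Ω] {X : ℝ≥0 → Ω → ℝ}
    (hX : ∀ t, Measurable (X t)) (y : ℝ) :
    Measurable fun ω => strictCrossingTime (fun t => X t ω) y := by
  refine measurable_of_Iio fun c => ?_
  have : (fun ω => strictCrossingTime (fun t => X t ω) y) ⁻¹' Set.Iio c =
      ⋃ k : ℕ, ⋃ n : ℕ, {ω | y < X (k / 2 ^ n) ω} ∩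
        {_ω | ((k / 2 ^ n : ℝ≥0) : ℝ≥0∞) < c} := by
    ext ω
    simp [strictCrossingTime_lt_iff]
  rw [this]
  exact .iUnion fun k => .iUnion fun n =>
    (measurableSet_lt measurable_const (hX _)).inter (MeasurableSet.const _)

/-- A property that holds on a right neighbourhood of `u` holds at a dyadic time arbitrarily close
to `u` on the right. -/
lemma exists_dyadic_of_eventually {p : ℝ≥0 → Prop} {u c : ℝ≥0} (h : ∀ᶠ v in 𝓝[≥] u, p v)
    (hc : u < c) : ∃ k n : ℕ, p (k / 2 ^ n) ∧ u ≤ (k / 2 ^ n : ℝ≥0) ∧ (k / 2 ^ n : ℝ≥0) < c := by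
  obtain ⟨r, hur, hr⟩ := (mem_nhdsGE_iff_exists_Ico_subset' hc).1 h
  have hur' : u < min r c := lt_min hur hc
  obtain ⟨n, hn⟩ := exists_pow_lt_of_lt_one (tsub_pos_of_lt hur') (by norm_num : (2 : ℝ≥0)⁻¹ < 1)
  have h2 : (0 : ℝ≥0) < 2 ^ n := by positivity
  have hlow : u ≤ (⌈u * 2 ^ n⌉₊ / 2 ^ n : ℝ≥0) := by
    rw [le_div_iff₀ h2]; exact Nat.le_ceil _
  have hup : (⌈u * 2 ^ n⌉₊ / 2 ^ n : ℝ≥0) < min r c := by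
    calc (⌈u * 2 ^ n⌉₊ / 2 ^ n : ℝ≥0) ≤ (u * 2 ^ n + 1) / 2 ^ n := by
          gcongr; exact (Nat.ceil_lt_add_one (zero_le)).le
      _ = u + 2⁻¹ ^ n := by rw [add_div, mul_div_cancel_right₀ _ h2.ne', inv_pow, one_div]
      _ < min r c := by rw [add_comm]; exact lt_tsub_iff_right.1 hn
  exact ⟨⌈u * 2 ^ n⌉₊, n, hr ⟨hlow, hup.trans_le (min_le_left _ _)⟩, hlow,
    hup.trans_le (min_le_right _ _)⟩

lemma IsCadlagPath.le_of_lt_strictCrossingTime {f : ℝ≥0 → ℝ} (hf : IsCadlagPath f) {y : ℝ}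
    {u : ℝ≥0} (hu : (u : ℝ≥0∞) < strictCrossingTime f y) : f u ≤ y := by
  by_contra! h
  obtain ⟨c, huc, hc⟩ := ENNReal.lt_iff_exists_nnreal_btwn.1 hu
  obtain ⟨k, n, hy, -, hlt⟩ := exists_dyadic_of_eventually
    (hf.tendsto_nhdsGE u (lt_mem_nhds h)) (by exact_mod_cast huc)
  exact absurd ((strictCrossingTime_le k n hy).trans_lt (by exact_mod_cast hlt)) (not_lt.2 hc.le)

/-- The first time on the grid `2⁻ⁿ ℕ` at which `f` lies strictly above `y`, capped at `N`. -/
noncomputable def gridExit (f : ℝ≥0 → ℝ) (y : ℝ) (N n : ℕ) : ℝ≥0 :=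
  exitIndex (fun k => f (k / 2 ^ n)) y (N * 2 ^ n) / 2 ^ n

lemma gridExit_le (f : ℝ≥0 → ℝ) (y : ℝ) (N n : ℕ) : gridExit f y N n ≤ N := by
  rw [gridExit, div_le_iff₀ (by positivity)]
  exact_mod_cast exitIndex_le _ _ _

lemma lt_apply_gridExit {f : ℝ≥0 → ℝ} {y : ℝ} {N n : ℕ} (h : gridExit f y N n < N) :
    y < f (gridExit f y N n) := by
  rw [gridExit, div_lt_iff₀ (by positivity)] at h
  exact lt_apply_exitIndex (u := fun k => f (k / 2 ^ n)) (by exact_mod_cast h)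

lemma strictCrossingTime_le_gridExit {f : ℝ≥0 → ℝ} {y : ℝ} {N n : ℕ} (h : gridExit f y N n < N) :
    strictCrossingTime f y ≤ gridExit f y N n :=
  strictCrossingTime_le _ _ (lt_apply_gridExit h)

lemma gridExit_le_of_lt {f : ℝ≥0 → ℝ} {y : ℝ} {N n j : ℕ} (hy : y < f (j / 2 ^ n)) :
    gridExit f y N n ≤ j / 2 ^ n := by
  rw [gridExit]
  gcongr
  by_contra! h
  exact absurd (le_of_lt_exitIndex h) (not_le.2 hy)

lemma gridExit_eq_of_le {f : ℝ≥0 → ℝ} {y : ℝ} {N : ℕ} (h : (N : ℝ≥0∞) ≤ strictCrossingTime f y)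
    (n : ℕ) : gridExit f y N n = N := by
  by_contra hne
  have hlt := lt_of_le_of_ne (gridExit_le f y N n) hne
  exact absurd (h.trans (strictCrossingTime_le_gridExit hlt)) (not_le.2 (by exact_mod_cast hlt))

/-- The grid crossing times decrease to the crossing time in the limit of vanishing mesh. -/
lemma tendsto_gridExit {f : ℝ≥0 → ℝ} {y : ℝ} {N : ℕ} (h : strictCrossingTime f y < N) :
    (∀ᶠ n in atTop, gridExit f y N n < N) ∧
      Tendsto (gridExit f y N) atTop (𝓝 (strictCrossingTime f y).toNNReal) := by
  have hup : ∀ c : ℝ≥0∞, strictCrossingTime f y < c →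
      ∀ᶠ n in atTop, (gridExit f y N n : ℝ≥0∞) < c := by
    intro c hc
    obtain ⟨k, m, hy, hlt⟩ := strictCrossingTime_lt_iff.1 hc
    filter_upwards [eventually_ge_atTop m] with n hn
    have hk : (k / 2 ^ m : ℝ≥0) = ((k * 2 ^ (n - m) : ℕ) : ℝ≥0) / 2 ^ n := by
      obtain ⟨d, rfl⟩ := Nat.exists_eq_add_of_le hn
      rw [Nat.add_sub_cancel_left, pow_add]
      push_cast
      rw [mul_div_mul_right _ _ (by positivity)]
    rw [hk] at hy hlt
    exact lt_of_le_of_lt (by exact_mod_cast gridExit_le_of_lt hy) hlt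
  have hN : ∀ᶠ n in atTop, gridExit f y N n < N := by
    filter_upwards [hup N h] with n hn using by exact_mod_cast hn
  refine ⟨hN, ?_⟩
  rw [← ENNReal.tendsto_coe, ENNReal.coe_toNNReal (h.trans (ENNReal.natCast_lt_top N)).ne]
  refine tendsto_order.2 ⟨fun a ha => ?_, fun c hc => hup c hc⟩
  filter_upwards [hN] with n hn using ha.trans_le (strictCrossingTime_le_gridExit hn)

/-- The value of the path along the grid crossing times converges to the level `y`: a path without
positive jumps creeps upwards through every level. -/
lemma NoPositiveJumps.tendsto_apply_gridExit {f : ℝ≥0 → ℝ} (hf : IsCadlagPath f)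
    (hj : NoPositiveJumps f) {y : ℝ} (h0 : f 0 ≤ y) {N : ℕ} (h : strictCrossingTime f y < N) :
    Tendsto (fun n => f (gridExit f y N n)) atTop (𝓝 y) := by
  obtain ⟨hN, ht⟩ := tendsto_gridExit h
  set τ := (strictCrossingTime f y).toNNReal with hτ
  have hτc : (τ : ℝ≥0∞) = strictCrossingTime f y :=
    ENNReal.coe_toNNReal (h.trans (ENNReal.natCast_lt_top N)).ne
  have hge : ∀ᶠ n in atTop, τ ≤ gridExit f y N n := by
    filter_upwards [hN] with n hn
    have := strictCrossingTime_le_gridExit hn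
    rw [← hτc] at this
    exact_mod_cast this
  have hlim : Tendsto (fun n => f (gridExit f y N n)) atTop (𝓝 (f τ)) :=
    (hf.tendsto_nhdsGE τ).comp (tendsto_nhdsWithin_iff.2 ⟨ht, hge⟩)
  have h1 : y ≤ f τ := ge_of_tendsto hlim (hN.mono fun n hn => (lt_apply_gridExit hn).le)
  have h2 : f τ ≤ y := by
    rcases eq_or_ne τ 0 with h' | h'
    · rwa [h']
    · exact hj.le_of_forall_lt hf (pos_iff_ne_zero.2 h') fun u hu =>
        hf.le_of_lt_strictCrossingTime (by rw [← hτc]; exact_mod_cast hu)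
  rwa [le_antisymm h2 h1] at hlim

/-- Comparison of the crossing times of `[y, ∞)` and of `(y', ∞)` for `y' < y`. -/
lemma strictCrossingTime_le_upCrossingTime {Ω : Type*} {X : ℝ≥0 → Ω → ℝ} {ω : Ω}
    (hf : IsCadlagPath fun t => X t ω) {y y' : ℝ} (hy : y' < y) :
    strictCrossingTime (fun t => X t ω) y' ≤ upCrossingTime X y ω := by
  refine le_sInf ?_
  rintro _ ⟨t, ⟨-, hyt⟩, rfl⟩
  by_contra! h
  exact absurd (hf.le_of_lt_strictCrossingTime h) (not_le.2 (hy.trans_le hyt))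

lemma upCrossingTime_le_strictCrossingTime {Ω : Type*} {X : ℝ≥0 → Ω → ℝ} {ω : Ω} {y : ℝ}
    (h0 : X 0 ω ≤ y) : upCrossingTime X y ω ≤ strictCrossingTime (fun t => X t ω) y := by
  refine le_iInf₂ fun p hp => sInf_le ⟨_, ⟨?_, hp.le⟩, rfl⟩
  refine pos_iff_ne_zero.2 fun hz => ?_
  rw [hz] at hp
  exact absurd hp (not_lt.2 h0)

lemma upCrossingTime_mono {Ω : Type*} (X : ℝ≥0 → Ω → ℝ) {y y' : ℝ} (h : y ≤ y') (ω : Ω) :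
    upCrossingTime X y ω ≤ upCrossingTime X y' ω :=
  sInf_le_sInf (Set.image_mono fun _ ht => ⟨ht.1, h.trans ht.2⟩)

/-! ### Exponential moments -/

section

variable {Ω : Type*} [MeasurableSpace Ω] {P : Measure Ω}

/-- The exponential moment `E[exp (s X_t)]`, as an extended nonnegative number. -/
noncomputable def expMoment (X : ℝ≥0 → Ω → ℝ) (P : Measure Ω) (s : ℝ) (t : ℝ≥0) : ℝ≥0∞ :=
  ∫⁻ ω, ENNReal.ofReal (Real.exp (s * X t ω)) ∂P

/-- The increment of `X` over the `i`-th interval of the grid of mesh `δ`. -/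
def gridStep {Ω : Type*} (X : ℝ≥0 → Ω → ℝ) (δ : ℝ≥0) (i : ℕ) (ω : Ω) : ℝ :=
  X ((i + 1 : ℕ) * δ) ω - X (i * δ) ω

lemma sum_gridStep {Ω : Type*} (X : ℝ≥0 → Ω → ℝ) (δ : ℝ≥0) (k : ℕ) (ω : Ω) :
    ∑ i ∈ Finset.range k, gridStep X δ i ω = X (k * δ) ω - X 0 ω := by
  have h := Finset.sum_range_sub (fun i : ℕ => X (i * δ) ω) k
  rwa [Nat.cast_zero, zero_mul] at h

namespace IsLevyProcess

variable {X : ℝ≥0 → Ω → ℝ}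

lemma measurable_gridStep (hX : IsLevyProcess X P) (δ : ℝ≥0) (i : ℕ) :
    Measurable (gridStep X δ i) :=
  (hX.measurable _).sub (hX.measurable _)

lemma iIndepFun_gridStep (hX : IsLevyProcess X P) (δ : ℝ≥0) : iIndepFun (gridStep X δ) P :=
  hX.indep_increments.nat (t := fun i : ℕ => (i : ℝ≥0) * δ) fun i j h => by
    dsimp only; gcongr

lemma lintegral_comp_gridStep (hX : IsLevyProcess X P) (δ : ℝ≥0) (i : ℕ) {g : ℝ → ℝ≥0∞}
    (hg : Measurable g) : ∫⁻ ω, g (gridStep X δ i ω) ∂P = ∫⁻ ω, g (X δ ω) ∂P := by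
  have h := (hX.stationary_increments (i * δ) δ).comp hg
  refine Eq.trans ?_ h.lintegral_eq
  simp only [gridStep, Function.comp, Nat.cast_add, Nat.cast_one, add_mul, one_mul]

lemma expMoment_zero [IsProbabilityMeasure P] (hX : IsLevyProcess X P) (s : ℝ) :
    expMoment X P s 0 = 1 := by
  have : (fun ω => ENNReal.ofReal (Real.exp (s * X 0 ω))) =ᵐ[P] fun _ => 1 := by
    filter_upwards [hX.start_zero] with ω hω using by simp [hω]
  rw [expMoment, lintegral_congr_ae this]
  simp

lemma expMoment_add (hX : IsLevyProcess X P) (s : ℝ) (u v : ℝ≥0) :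
    expMoment X P s (u + v) = expMoment X P s u * expMoment X P s v := by
  have hg : Measurable fun x : ℝ => ENNReal.ofReal (Real.exp (s * x)) := by fun_prop
  have hind := (hX.indep_increments.indepFun_eval_sub (zero_le (a := u))
    (le_self_add (b := v)) hX.start_zero).comp hg hg
  have h := lintegral_mul_eq_lintegral_mul_lintegral_of_indepFun
    (hg.comp (hX.measurable u)) (hg.comp ((hX.measurable (u + v)).sub (hX.measurable u))) hind
  have h2 := ((hX.stationary_increments u v).comp hg).lintegral_eq
  simp only [Function.comp, Pi.mul_apply, Pi.sub_apply] at h h2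
  rw [h2] at h
  rw [expMoment, expMoment, expMoment, ← h]
  refine lintegral_congr fun ω => ?_
  rw [← ENNReal.ofReal_mul (Real.exp_pos _).le, ← Real.exp_add]
  congr 2
  ring

lemma expMoment_nat_mul [IsProbabilityMeasure P] (hX : IsLevyProcess X P) (s : ℝ) (k : ℕ)
    (δ : ℝ≥0) : expMoment X P s (k * δ) = expMoment X P s δ ^ k := by
  induction k with
  | zero => simp [hX.expMoment_zero]
  | succ k ih => rw [Nat.cast_succ, add_mul, one_mul, hX.expMoment_add, ih, pow_succ]

/-- By right-continuity at `0`, a short initial piece of the path stays below `1` with probability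
close to `1`. -/
lemma tendsto_measure_exceed [IsProbabilityMeasure P] (hX : IsLevyProcess X P) :
    Tendsto (fun m : ℕ => P (⋃ q : {q : ℚ≥0 // (q : ℝ≥0) ≤ 1 / (m + 1)}, {ω | 1 < X (q : ℚ≥0) ω}))
      atTop (𝓝 0) := by
  have hlim := tendsto_measure_iInter_atTop (μ := P)
    (s := fun m : ℕ =>
      ⋃ q : {q : ℚ≥0 // (q : ℝ≥0) ≤ 1 / (m + 1)}, {ω | 1 < X (q : ℚ≥0) ω})
    (fun m => (MeasurableSet.iUnion fun q =>
      measurableSet_lt measurable_const (hX.measurable _)).nullMeasurableSet)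
    (fun m m' h => by
      refine Set.iUnion_subset fun q => Set.subset_iUnion_of_subset ⟨q.1, q.2.trans ?_⟩ le_rfl
      gcongr)
    ⟨0, measure_ne_top _ _⟩
  refine (?_ : P _ = 0) ▸ hlim
  rw [← compl_mem_ae_iff]
  filter_upwards [hX.start_zero, hX.cadlag] with ω h0 hc
  have hev : ∀ᶠ t in 𝓝[≥] (0 : ℝ≥0), X t ω < 1 :=
    hc.tendsto_nhdsGE 0 (gt_mem_nhds (by simp [h0]))
  obtain ⟨r, hr0, hr⟩ := (mem_nhdsGE_iff_exists_Ico_subset' (zero_lt_one)).1 hev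
  obtain ⟨m, hm⟩ := exists_nat_one_div_lt (NNReal.coe_pos.2 hr0)
  have hm' : 1 / ((m : ℝ≥0) + 1) < r := by rw [← NNReal.coe_lt_coe]; exact_mod_cast hm
  simp only [Set.mem_compl_iff, Set.mem_iInter, Set.mem_iUnion, not_forall, not_exists]
  refine ⟨m, fun q hq => ?_⟩
  have hlt : X (q : ℚ≥0) ω < 1 := hr ⟨zero_le, q.2.trans_lt hm'⟩
  exact absurd hq (not_lt.2 hlt.le)

/-- The key estimate for exponential moments. Over a time interval of length `1 / (m + 1)` on which
the path rarely exceeds `1`, the walk obtained from a grid by truncating its steps at `1` has an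
exponential moment bounded independently of the grid: otherwise its exponential martingale,
stopped above level `1` where it is at most `exp (2 s)`, would lose mass. -/
lemma lintegral_exp_truncated_walk_le [IsProbabilityMeasure P] (hX : IsLevyProcess X P) {s : ℝ}
    (hs : 0 ≤ s) {m : ℕ}
    (hm : P (⋃ q : {q : ℚ≥0 // (q : ℝ≥0) ≤ 1 / (m + 1)}, {ω | 1 < X (q : ℚ≥0) ω}) ≤
      ENNReal.ofReal (Real.exp (-(2 * s)) / 2)) {N : ℕ} (hN : 0 < N) :
    ∫⁻ ω, ENNReal.ofReal (Real.exp (s * ∑ i ∈ Finset.range N,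
      min (gridStep X (1 / ((m + 1) * N)) i ω) 1)) ∂P ≤ ENNReal.ofReal (2 * Real.exp (2 * s)) := by
  classical
  set E : Set Ω := ⋃ q : {q : ℚ≥0 // (q : ℝ≥0) ≤ 1 / (m + 1)}, {ω | 1 < X (q : ℚ≥0) ω} with hE
  have hEm : MeasurableSet E := .iUnion fun q =>
    measurableSet_lt measurable_const (hX.measurable _)
  set δ : ℝ≥0 := 1 / ((m + 1) * N) with hδ
  set ξ : ℕ → Ω → ℝ := fun i ω => min (gridStep X δ i ω) 1 with hξ
  have hmin : Measurable fun x : ℝ => min x 1 := measurable_id.min measurable_const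
  have hξm : ∀ i, Measurable (ξ i) := fun i => hmin.comp (hX.measurable_gridStep δ i)
  have hind : iIndepFun ξ P := (hX.iIndepFun_gridStep δ).comp (fun _ x => min x 1) fun _ => hmin
  -- The common exponential moment `a` of the truncated steps is positive and finite.
  set A : ℝ≥0∞ := ∫⁻ ω, ENNReal.ofReal (Real.exp (s * min (X δ ω) 1)) ∂P with hA
  have hAtop : A ≠ ∞ := by
    refine ne_top_of_le_ne_top (b := ENNReal.ofReal (Real.exp s)) ENNReal.ofReal_ne_top ?_
    calc A ≤ ∫⁻ _, ENNReal.ofReal (Real.exp s) ∂P := by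
          refine lintegral_mono fun ω => ?_
          gcongr
          exact mul_le_of_le_one_right hs (min_le_right _ _)
      _ = _ := by simp
  have hA0 : A ≠ 0 := by
    intro h
    rw [hA, lintegral_eq_zero_iff (by have := hX.measurable δ; fun_prop)] at h
    have : ∀ᵐ _ω ∂P, False := by
      filter_upwards [h] with ω hω
      have := Real.exp_pos (s * min (X δ ω) 1)
      simp only [Pi.zero_apply, ENNReal.ofReal_eq_zero] at hω
      linarith
    simp only [eventually_false_iff_eq_bot, ae_eq_bot] at this
    exact IsProbabilityMeasure.ne_zero P this
  have ha : 0 < A.toReal := ENNReal.toReal_pos hA0 hAtop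
  have hstep : ∀ i, ∫⁻ ω, ENNReal.ofReal (Real.exp (s * ξ i ω)) ∂P
      = ENNReal.ofReal A.toReal := fun i => by
    rw [ENNReal.ofReal_toReal hAtop]
    exact hX.lintegral_comp_gridStep δ i
      (g := fun x => ENNReal.ofReal (Real.exp (s * min x 1))) (by fun_prop)
  set S : ℕ → Ω → ℝ := fun k ω => ∑ i ∈ Finset.range k, ξ i ω with hS
  have hprod : ∫⁻ ω, ENNReal.ofReal (Real.exp (s * S N ω)) ∂P = ENNReal.ofReal (A.toReal ^ N) := by
    have := lintegral_prod_eq_prod_lintegral_of_indepFun (Finset.range N)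
      (fun i ω => ENNReal.ofReal (Real.exp (s * ξ i ω)))
      (hind.comp (fun _ x => ENNReal.ofReal (Real.exp (s * x))) fun _ => by fun_prop)
      (fun i => by have := hξm i; fun_prop)
    simp only [hstep, Finset.prod_const, Finset.card_range] at this
    rw [ENNReal.ofReal_pow ha.le, ← this]
    refine lintegral_congr fun ω => ?_
    rw [← ENNReal.ofReal_prod_of_nonneg fun _ _ => (Real.exp_pos _).le, ← Real.exp_sum,
      ← Finset.mul_sum]
  change ∫⁻ ω, ENNReal.ofReal (Real.exp (s * S N ω)) ∂P ≤ _
  rw [hprod]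
  refine ENNReal.ofReal_le_ofReal ?_
  rcases le_or_gt A.toReal 1 with h1 | h1
  · calc A.toReal ^ N ≤ 1 := pow_le_one₀ ha.le h1
      _ ≤ 2 * Real.exp (2 * s) := by linarith [Real.one_le_exp (x := 2 * s) (by positivity)]
  have hopt := lintegral_exp_stopped_walk hξm hind ha hstep S (fun _ _ => rfl) 1 N
  have hsucc : ∀ k ω, S (k + 1) ω ≤ S k ω + 1 := fun k ω => by
    simp only [hS, Finset.sum_range_succ]
    gcongr
    exact min_le_right _ _
  have hbound : ∀ᵐ ω ∂P, ENNReal.ofReal (Real.exp (s * S (exitIndex (fun n => S n ω) 1 N) ω) /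
      A.toReal ^ exitIndex (fun n => S n ω) 1 N) ≤
        ENNReal.ofReal (Real.exp (2 * s)) * E.indicator 1 ω +
          ENNReal.ofReal (Real.exp (2 * s) / A.toReal ^ N) := by
    filter_upwards [hX.start_zero] with ω h0
    set k := exitIndex (fun n => S n ω) 1 N with hk
    have hkN : k ≤ N := exitIndex_le _ _ _
    have hSk : S k ω ≤ 2 := by
      rcases Nat.eq_zero_or_pos k with h | h
      · rw [h]; simp [hS]
      · obtain ⟨j, hj⟩ := Nat.exists_eq_succ_of_ne_zero h.ne'
        have : S j ω ≤ 1 := le_of_lt_exitIndex (u := fun n => S n ω) (k := N) (by omega)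
        rw [hj]
        linarith [hsucc j ω]
    have hexp : Real.exp (s * S k ω) ≤ Real.exp (2 * s) := by
      rw [mul_comm 2 s]; gcongr
    rcases hkN.lt_or_eq with hlt | heq
    · have hgt : 1 < S k ω := lt_apply_exitIndex (u := fun n => S n ω) hlt
      have hXk : 1 < X (k * δ) ω := by
        have h2 := sum_gridStep X δ k ω
        rw [h0, sub_zero] at h2
        rw [← h2]
        exact hgt.trans_le (Finset.sum_le_sum fun i _ => min_le_left _ _)
      have hωE : ω ∈ E := by
        refine Set.mem_iUnion.2 ⟨⟨k * (1 / ((m + 1) * N)), ?_⟩, ?_⟩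
        · push_cast
          have : (k : ℝ≥0) / N ≤ 1 := by
            rw [div_le_one (by positivity)]; exact_mod_cast hkN
          calc (k : ℝ≥0) * (1 / ((m + 1) * N)) = (k / N) * (1 / (m + 1)) := by
                field_simp
            _ ≤ 1 / (m + 1) := mul_le_of_le_one_left zero_le this
        · change 1 < X _ ω
          push_cast
          exact hXk
      rw [Set.indicator_of_mem hωE, Pi.one_apply, mul_one]
      refine le_add_right (ENNReal.ofReal_le_ofReal ?_)
      exact (div_le_self (Real.exp_pos _).le (one_le_pow₀ h1.le)).trans hexp
    · rw [heq] at hexp ⊢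
      refine le_add_left (ENNReal.ofReal_le_ofReal ?_)
      gcongr
  have hint := lintegral_mono_ae hbound
  rw [hopt, lintegral_add_right _ measurable_const,
    lintegral_const_mul _ (measurable_one.indicator hEm), lintegral_indicator_one hEm,
    lintegral_const, measure_univ, mul_one] at hint
  have hint2 : (1 : ℝ≥0∞) ≤ ENNReal.ofReal (1 / 2 + Real.exp (2 * s) / A.toReal ^ N) := by
    refine hint.trans ?_
    rw [ENNReal.ofReal_add (by norm_num) (by positivity)]
    gcongr
    refine (mul_le_mul_right hm _).trans ?_
    rw [← ENNReal.ofReal_mul (Real.exp_pos _).le, Real.exp_neg]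
    refine ENNReal.ofReal_le_ofReal (le_of_eq ?_)
    field_simp
  rw [ENNReal.one_le_ofReal] at hint2
  have h3 : 1 / 2 ≤ Real.exp (2 * s) / A.toReal ^ N := by linarith
  rw [le_div_iff₀ (by positivity)] at h3
  linarith

/-- A Lévy process without positive jumps has finite exponential moments: for a fine enough grid
the truncated walk coincides with the process, so the bounds for the truncated walks pass to the
limit by Fatou's lemma. -/
lemma expMoment_one_ne_top [IsProbabilityMeasure P] (hX : IsLevyProcess X P)
    (hj : ∀ᵐ ω ∂P, NoPositiveJumps fun t => X t ω) {s : ℝ} (hs : 0 ≤ s) :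
    expMoment X P s 1 ≠ ∞ := by
  obtain ⟨m, hm⟩ := ((tendsto_order.1 hX.tendsto_measure_exceed).2
    (ENNReal.ofReal (Real.exp (-(2 * s)) / 2)) (by simp; positivity)).exists
  have h1 : expMoment X P s (1 / (m + 1)) ≤ ENNReal.ofReal (2 * Real.exp (2 * s)) := by
    set F : ℕ → Ω → ℝ≥0∞ := fun N ω => ENNReal.ofReal (Real.exp (s * ∑ i ∈ Finset.range (N + 1),
      min (gridStep X (1 / ((m + 1) * (N + 1 : ℕ))) i ω) 1)) with hF
    have hFm : ∀ N, Measurable (F N) := fun N => by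
      have := fun i => hX.measurable_gridStep (1 / ((m + 1) * (N + 1 : ℕ))) i
      fun_prop
    have hlim : ∀ᵐ ω ∂P, ENNReal.ofReal (Real.exp (s * X (1 / (m + 1)) ω)) =
        liminf (fun N => F N ω) atTop := by
      filter_upwards [hX.start_zero, hX.cadlag, hj] with ω h0 hc hjω
      obtain ⟨d, hd, hinc⟩ := hjω.exists_forall_sub_le hc (1 / (m + 1)) one_pos
      have hev : ∀ᶠ N : ℕ in atTop, F N ω = ENNReal.ofReal (Real.exp (s * X (1 / (m + 1)) ω)) := by
        obtain ⟨N₀, hN₀⟩ := exists_nat_one_div_lt hd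
        filter_upwards [eventually_ge_atTop N₀] with N hN
        set δ : ℝ≥0 := 1 / ((m + 1) * (N + 1 : ℕ)) with hδ
        have hNδ : ((N + 1 : ℕ) : ℝ≥0) * δ = 1 / (m + 1) := by rw [hδ]; field_simp
        have hδd : (δ : ℝ) < d := by
          refine lt_of_le_of_lt ?_ hN₀
          rw [hδ]
          push_cast
          gcongr
          have : (N₀ : ℝ) ≤ N := by exact_mod_cast hN
          nlinarith [(Nat.cast_nonneg m : (0 : ℝ) ≤ m), (Nat.cast_nonneg N : (0 : ℝ) ≤ N)]
        have hmin : ∀ i ∈ Finset.range (N + 1), min (gridStep X δ i ω) 1 = gridStep X δ i ω := by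
          intro i hi
          refine min_eq_left (hinc _ _ ?_ ?_ ?_)
          · gcongr; omega
          · rw [← hNδ]
            have := Finset.mem_range.1 hi
            gcongr
            omega
          · push_cast
            linarith
        simp only [hF]
        rw [← hδ, Finset.sum_congr rfl hmin, sum_gridStep, h0, sub_zero, hNδ]
      exact ((tendsto_congr' hev).2 tendsto_const_nhds).liminf_eq.symm
    rw [expMoment, lintegral_congr_ae hlim]
    refine (lintegral_liminf_le hFm).trans ?_
    refine liminf_le_of_le (by isBoundedDefault) fun b hb => ?_
    obtain ⟨N, hN⟩ := hb.exists
    exact hN.trans (hX.lintegral_exp_truncated_walk_le hs hm.le N.succ_pos)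
  have h2 := hX.expMoment_nat_mul s (m + 1) (1 / (m + 1))
  have h3 : ((m + 1 : ℕ) : ℝ≥0) * (1 / (m + 1)) = 1 := by push_cast; field_simp
  rw [h3] at h2
  rw [h2]
  exact ENNReal.pow_ne_top (ne_top_of_le_ne_top ENNReal.ofReal_ne_top h1)

end IsLevyProcess

end

/-! ### The Laplace exponent and its right inverse -/

section

variable {Ω : Type*} [MeasurableSpace Ω] {P : Measure Ω} {X : ℝ≥0 → Ω → ℝ}

/-- If `X₁ ≤ 0` almost surely, then so are all dyadic increments, since `X₁` is positive as soon as
each of its `2 ^ n` independent, identically distributed increments is. -/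
lemma IsLevyProcess.gridStep_nonpos (hX : IsLevyProcess X P) (h : P {ω | 0 < X 1 ω} = 0)
    (n i : ℕ) : ∀ᵐ ω ∂P, gridStep X (1 / 2 ^ n) i ω ≤ 0 := by
  set δ : ℝ≥0 := 1 / 2 ^ n with hδ
  have hδ1 : ((2 ^ n : ℕ) : ℝ≥0) * δ = 1 := by rw [hδ]; push_cast; field_simp
  have hmeas : ∀ j, P (gridStep X δ j ⁻¹' Set.Ioi 0) = P (X δ ⁻¹' Set.Ioi 0) := fun j => by
    have := hX.lintegral_comp_gridStep δ j (g := (Set.Ioi (0 : ℝ)).indicator 1)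
      (measurable_one.indicator measurableSet_Ioi)
    rw [← lintegral_indicator_one (hX.measurable_gridStep δ j measurableSet_Ioi),
      ← lintegral_indicator_one (hX.measurable δ measurableSet_Ioi)]
    exact this
  have hprod := (hX.iIndepFun_gridStep δ).measure_inter_preimage_eq_mul (Finset.range (2 ^ n))
    (sets := fun _ => Set.Ioi 0) fun _ _ => measurableSet_Ioi
  have hzero : P (⋂ j ∈ Finset.range (2 ^ n), gridStep X δ j ⁻¹' Set.Ioi 0) = 0 := by
    rw [← compl_mem_ae_iff]
    have h' : ∀ᵐ ω ∂P, ¬ 0 < X 1 ω := by simpa [ae_iff] using h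
    filter_upwards [h', hX.start_zero] with ω hω h0 hmem
    refine hω ?_
    have hsum := sum_gridStep X δ (2 ^ n) ω
    rw [hδ1, h0, sub_zero] at hsum
    rw [← hsum]
    exact Finset.sum_pos (fun j hj => Set.mem_iInter₂.1 hmem j hj) ⟨0, by simp⟩
  rw [hzero, Finset.prod_congr rfl fun j _ => hmeas j, Finset.prod_const] at hprod
  have h0 := eq_zero_of_pow_eq_zero hprod.symm
  rw [← hmeas i] at h0
  rw [ae_iff]
  simpa [Set.preimage] using h0

namespace IsSpectrallyNegativeLevy

/-- As the paths are not almost surely nonincreasing, `X₁` is positive with positive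
probability. -/
lemma measure_pos (hX : IsSpectrallyNegativeLevy X P) : P {ω | 0 < X 1 ω} ≠ 0 := by
  intro h
  refine hX.not_neg_subordinator ?_
  have hall : ∀ᵐ ω ∂P, ∀ n i : ℕ, gridStep X (1 / 2 ^ n) i ω ≤ 0 :=
    ae_all_iff.2 fun n => ae_all_iff.2 fun i => hX.toIsLevyProcess.gridStep_nonpos h n i
  filter_upwards [hall, hX.cadlag] with ω hω hc
  have hgrid : ∀ n : ℕ, Antitone fun k : ℕ => X (k / 2 ^ n) ω := fun n =>
    antitone_nat_of_succ_le fun k => by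
      have := hω n k
      simp only [gridStep, mul_one_div] at this
      exact sub_nonpos.1 this
  intro u v huv
  by_contra! hlt
  have huv' : u < v := lt_of_le_of_ne huv (by rintro rfl; exact lt_irrefl _ hlt)
  set y := (X u ω + X v ω) / 2 with hy
  obtain ⟨k, n, hku, -, hkv⟩ := exists_dyadic_of_eventually
    (hc.tendsto_nhdsGE u (gt_mem_nhds (show X u ω < y by linarith))) huv'
  obtain ⟨j, m, hjv, hvj, -⟩ := exists_dyadic_of_eventually
    (hc.tendsto_nhdsGE v (lt_mem_nhds (show y < X v ω by linarith))) (lt_add_one v)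
  have e1 : (k / 2 ^ n : ℝ≥0) = ((k * 2 ^ m : ℕ) : ℝ≥0) / 2 ^ (n + m) := by
    push_cast
    rw [pow_add, mul_div_mul_right _ _ (by positivity)]
  have e2 : (j / 2 ^ m : ℝ≥0) = ((2 ^ n * j : ℕ) : ℝ≥0) / 2 ^ (n + m) := by
    push_cast
    rw [pow_add, mul_div_mul_left _ _ (by positivity)]
  have hle : k * 2 ^ m ≤ 2 ^ n * j := by
    have h1 := hkv.trans_le hvj
    rw [e1, e2, div_lt_div_iff_of_pos_right (by positivity)] at h1
    exact_mod_cast h1.le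
  have := hgrid (n + m) hle
  simp only at this
  rw [← e1, ← e2] at this
  have hku' : X (k / 2 ^ n) ω < y := hku
  have hjv' : y < X (j / 2 ^ m) ω := hjv
  linarith

variable [IsProbabilityMeasure P]

lemma integrable_exp (hX : IsSpectrallyNegativeLevy X P) {s : ℝ} (hs : 0 ≤ s) :
    Integrable (fun ω => Real.exp (s * X 1 ω)) P := by
  refine ⟨by have := hX.measurable 1; fun_prop, ?_⟩
  rw [hasFiniteIntegral_iff_ofReal (ae_of_all _ fun ω => (Real.exp_pos _).le)]
  exact (hX.toIsLevyProcess.expMoment_one_ne_top hX.no_positive_jumps hs).lt_top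

lemma expMoment_one (hX : IsSpectrallyNegativeLevy X P) {s : ℝ} (hs : 0 ≤ s) :
    expMoment X P s 1 = ENNReal.ofReal (Real.exp (laplaceExponent X P s)) := by
  have hpos : 0 < ∫ ω, Real.exp (s * X 1 ω) ∂P := mgf_pos (hX.integrable_exp hs)
  rw [laplaceExponent, Real.exp_log hpos,
    ofReal_integral_eq_lintegral_ofReal (hX.integrable_exp hs)
      (ae_of_all _ fun ω => (Real.exp_pos _).le), expMoment]

lemma expMoment_natCast (hX : IsSpectrallyNegativeLevy X P) {s : ℝ} (hs : 0 ≤ s) (N : ℕ) :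
    expMoment X P s N = ENNReal.ofReal (Real.exp (laplaceExponent X P s * N)) := by
  have := hX.toIsLevyProcess.expMoment_nat_mul s N 1
  rw [mul_one] at this
  rw [this, hX.expMoment_one hs, ← ENNReal.ofReal_pow (Real.exp_pos _).le, ← Real.exp_nat_mul,
    mul_comm]

lemma expMoment_dyadic (hX : IsSpectrallyNegativeLevy X P) {s : ℝ} (hs : 0 ≤ s) (n : ℕ) :
    expMoment X P s (1 / 2 ^ n) =
      ENNReal.ofReal (Real.exp (laplaceExponent X P s / 2 ^ n)) := by
  have h := hX.toIsLevyProcess.expMoment_nat_mul s (2 ^ n) (1 / 2 ^ n)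
  rw [show ((2 ^ n : ℕ) : ℝ≥0) * (1 / 2 ^ n) = 1 by push_cast; field_simp,
    hX.expMoment_one hs] at h
  refine (ENNReal.pow_right_strictMono (n := 2 ^ n) (by positivity)).injective ?_
  rw [← h, ← ENNReal.ofReal_pow (Real.exp_pos _).le, ← Real.exp_nat_mul]
  push_cast
  rw [mul_div_cancel₀ _ (by positivity)]

lemma continuousOn_laplaceExponent (hX : IsSpectrallyNegativeLevy X P) :
    ContinuousOn (laplaceExponent X P) (Set.Ici 1) := by
  have hsub : Set.Ici (1 : ℝ) ⊆ interior (integrableExpSet (X 1) P) := by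
    have h0 : Set.Ioi (0 : ℝ) ⊆ interior (integrableExpSet (X 1) P) :=
      interior_maximal (fun s hs => hX.integrable_exp (le_of_lt hs)) isOpen_Ioi
    exact fun s hs => h0 (Set.mem_Ioi.2 (zero_lt_one.trans_le (Set.mem_Ici.1 hs)))
  exact (continuousOn_mgf.mono hsub).log fun s hs =>
    (mgf_pos (hX.integrable_exp (zero_le_one.trans hs))).ne'

lemma tendsto_laplaceExponent (hX : IsSpectrallyNegativeLevy X P) :
    Tendsto (laplaceExponent X P) atTop atTop := by
  have hex : ∃ n : ℕ, P {ω | 1 / ((n : ℝ) + 1) ≤ X 1 ω} ≠ 0 := by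
    by_contra! h
    refine hX.measure_pos (measure_mono_null (fun ω hω => ?_) (measure_iUnion_null h))
    obtain ⟨n, hn⟩ := exists_nat_one_div_lt (show 0 < X 1 ω from hω)
    exact Set.mem_iUnion.2 ⟨n, hn.le⟩
  obtain ⟨n, hn⟩ := hex
  set ε : ℝ := 1 / ((n : ℝ) + 1) with hε
  have hε0 : 0 < ε := by positivity
  have hp : 0 < P.real {ω | ε ≤ X 1 ω} := ENNReal.toReal_pos hn (measure_ne_top _ _)
  have hlin : Tendsto (fun s : ℝ => s * ε + Real.log (P.real {ω | ε ≤ X 1 ω})) atTop atTop :=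
    tendsto_atTop_add_const_right _ _ (tendsto_id.atTop_mul_const hε0)
  refine tendsto_atTop_mono' _ ?_ hlin
  filter_upwards [eventually_ge_atTop 0] with s hs
  have hch := measure_ge_le_exp_mul_mgf (μ := P) ε hs (hX.integrable_exp hs)
  have hlog := Real.log_le_log hp hch
  rw [Real.log_mul (Real.exp_pos _).ne' (mgf_pos (hX.integrable_exp hs)).ne', Real.log_exp] at hlog
  change _ ≤ Real.log (mgf (X 1) P s)
  linarith

/-- Once the Laplace exponent is below `α` at some `s₀ ≥ 1`, the level set of `α` is nonempty by the
intermediate value theorem, compact, and its largest element lies beyond `s₀`. -/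
lemma isGreatest_rightInverse (hX : IsSpectrallyNegativeLevy X P) {α s₀ : ℝ} (h1 : 1 ≤ s₀)
    (hs₀ : laplaceExponent X P s₀ < α) :
    IsGreatest {s : ℝ | 1 ≤ s ∧ laplaceExponent X P s = α} (rightInverse X P α) ∧
      s₀ < rightInverse X P α := by
  set A : Set ℝ := {s : ℝ | 1 ≤ s ∧ laplaceExponent X P s = α} with hA
  obtain ⟨b, hb⟩ := eventually_atTop.1 (hX.tendsto_laplaceExponent.eventually_gt_atTop α)
  have hcont := hX.continuousOn_laplaceExponent
  have hbdd : BddAbove A := by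
    refine ⟨b, fun s hs => ?_⟩
    by_contra! h
    exact absurd hs.2 (hb s h.le).ne'
  have hclosed : IsClosed A := by
    have := hcont.preimage_isClosed_of_isClosed isClosed_Ici (isClosed_singleton (x := α))
    exact this
  obtain ⟨s, hs, hsα⟩ := intermediate_value_Icc (le_max_right b s₀)
    (hcont.mono fun x hx => h1.trans hx.1) ⟨hs₀.le, (hb _ (le_max_left b s₀)).le⟩
  have hsA : s ∈ A := ⟨h1.trans hs.1, hsα⟩
  have hs₀s : s₀ < s := lt_of_le_of_ne hs.1 (by rintro rfl; exact absurd hsα hs₀.ne)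
  exact ⟨⟨hclosed.csSup_mem ⟨s, hsA⟩ hbdd, fun x hx => le_csSup hbdd hx⟩,
    hs₀s.trans_le (le_csSup hbdd hsA)⟩

end IsSpectrallyNegativeLevy

lemma exists_lt_of_deriv_neg {f : ℝ → ℝ} {a : ℝ} (h : deriv f a < 0) : ∃ s, a < s ∧ f s < f a := by
  have hd := (differentiableAt_of_deriv_ne_zero h.ne).hasDerivAt
  have hslope := (hasDerivAt_iff_tendsto_slope.1 hd).mono_left
    (nhdsWithin_mono a (s := Set.Ioi a) fun x hx => (Set.mem_Ioi.1 hx).ne')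
  obtain ⟨s, hs, has⟩ := ((hslope.eventually (gt_mem_nhds h)).and self_mem_nhdsWithin).exists
  refine ⟨s, has, ?_⟩
  have has' : 0 < s - a := sub_pos.2 has
  have hneg : (f s - f a) / (s - a) < 0 := by
    have : slope f a s < 0 := hs
    rwa [slope_def_field] at this
  rw [div_neg_iff] at hneg
  rcases hneg with h | h <;> linarith [h.1, h.2]

end

/-! ### The transform of the strict crossing time -/

section

variable {Ω : Type*} [MeasurableSpace Ω] {P : Measure Ω}
  {X : ℝ≥0 → Ω → ℝ}

lemma IsLevyProcess.measurable_exp_gridExit (hX : IsLevyProcess X P) (s b y : ℝ) (N n : ℕ) :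
    Measurable fun ω => ENNReal.ofReal (Real.exp
      (s * X (gridExit (fun t => X t ω) y N n) ω - b * gridExit (fun t => X t ω) y N n)) :=
  measurable_apply_exitIndex (u := fun k => X (k / 2 ^ n)) (fun k => hX.measurable _)
    (W := fun k ω => ENNReal.ofReal (Real.exp
      (s * X (k / 2 ^ n) ω - b * ((k / 2 ^ n : ℝ≥0) : ℝ))))
    (fun k => by have := hX.measurable (k / 2 ^ n); fun_prop) y (N * 2 ^ n)

variable [IsProbabilityMeasure P]

/-- Integrals pass to an almost sure limit when the second moments are bounded. -/
lemma lintegral_eq_of_tendsto_of_sq_le {g : ℕ → Ω → ℝ≥0∞} (hg : ∀ n, Measurable (g n))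
    {G : Ω → ℝ≥0∞} (hG : ∀ᵐ ω ∂P, Tendsto (fun n => g n ω) atTop (𝓝 (G ω))) {C c : ℝ≥0∞}
    (hC : C ≠ ∞) (hsq : ∀ n, ∫⁻ ω, g n ω ^ 2 ∂P ≤ C) (hc : ∀ n, ∫⁻ ω, g n ω ∂P = c) :
    ∫⁻ ω, G ω ∂P = c := by
  refine le_antisymm ?_ ?_
  · have hlim : ∀ᵐ ω ∂P, G ω = liminf (fun n => g n ω) atTop :=
      hG.mono fun ω hω => hω.liminf_eq.symm
    rw [lintegral_congr_ae hlim]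
    refine (lintegral_liminf_le hg).trans ?_
    simp [hc]
  -- Truncation at the level `R` costs at most `C / R`.
  have key : ∀ R : ℕ, 0 < R → c ≤ ∫⁻ ω, G ω ∂P + C * (R : ℝ≥0∞)⁻¹ := by
    intro R hR
    have hR0 : (R : ℝ≥0∞) ≠ 0 := by exact_mod_cast hR.ne'
    have hRt : (R : ℝ≥0∞) ≠ ∞ := ENNReal.natCast_ne_top R
    have hle : ∀ n, c ≤ ∫⁻ ω, min (g n ω) R ∂P + C * (R : ℝ≥0∞)⁻¹ := fun n => by
      calc c = ∫⁻ ω, g n ω ∂P := (hc n).symm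
        _ ≤ ∫⁻ ω, (min (g n ω) R + g n ω ^ 2 * (R : ℝ≥0∞)⁻¹) ∂P := by
          refine lintegral_mono fun ω => ?_
          rcases le_total (g n ω) R with h | h
          · rw [min_eq_left h]
            exact le_self_add
          · refine le_add_left ?_
            rw [sq, mul_assoc]
            refine le_mul_of_one_le_right' ?_
            rw [← ENNReal.mul_inv_cancel hR0 hRt]
            gcongr
        _ = ∫⁻ ω, min (g n ω) R ∂P + (∫⁻ ω, g n ω ^ 2 ∂P) * (R : ℝ≥0∞)⁻¹ := by
          rw [lintegral_add_left ((hg n).min measurable_const),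
            lintegral_mul_const _ ((hg n).pow_const 2)]
        _ ≤ _ := by gcongr; exact hsq n
    have hdct : Tendsto (fun n => ∫⁻ ω, min (g n ω) R ∂P) atTop (𝓝 (∫⁻ ω, min (G ω) R ∂P)) :=
      tendsto_lintegral_of_dominated_convergence (fun _ => (R : ℝ≥0∞))
        (fun n => (hg n).min measurable_const) (fun n => ae_of_all _ fun ω => min_le_right _ _)
        (by simp) (hG.mono fun ω hω => hω.min tendsto_const_nhds)
    refine (ge_of_tendsto' (hdct.add_const _) hle).trans ?_
    gcongr
    exact min_le_left _ _
  have h0 : Tendsto (fun R : ℕ => ∫⁻ ω, G ω ∂P + C * (R : ℝ≥0∞)⁻¹) atTop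
      (𝓝 (∫⁻ ω, G ω ∂P + C * 0)) :=
    (ENNReal.Tendsto.const_mul ENNReal.tendsto_inv_nat_nhds_zero (Or.inr hC)).const_add _
  rw [mul_zero, add_zero] at h0
  exact ge_of_tendsto h0 ((eventually_gt_atTop 0).mono key)

namespace IsSpectrallyNegativeLevy

/-- Optional stopping of the exponential martingale at a grid crossing time. -/
lemma lintegral_exp_gridExit (hX : IsSpectrallyNegativeLevy X P) {s : ℝ} (hs : 0 ≤ s) (y : ℝ)
    (N n : ℕ) :
    ∫⁻ ω, ENNReal.ofReal (Real.exp (s * X (gridExit (fun t => X t ω) y N n) ω -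
      laplaceExponent X P s * gridExit (fun t => X t ω) y N n)) ∂P = 1 := by
  have hstep : ∀ i, ∫⁻ ω, ENNReal.ofReal (Real.exp (s * gridStep X (1 / 2 ^ n) i ω)) ∂P =
      ENNReal.ofReal (Real.exp (laplaceExponent X P s / 2 ^ n)) := fun i => by
    rw [← hX.expMoment_dyadic hs]
    exact hX.toIsLevyProcess.lintegral_comp_gridStep _ i
      (g := fun x => ENNReal.ofReal (Real.exp (s * x))) (by fun_prop)
  rw [← lintegral_exp_stopped_walk (hX.toIsLevyProcess.measurable_gridStep (1 / 2 ^ n))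
    (hX.toIsLevyProcess.iIndepFun_gridStep _) (Real.exp_pos _) hstep
    (fun k ω => X (k / 2 ^ n) ω - X 0 ω)
    (fun k ω => by rw [sum_gridStep, mul_one_div]) y (N * 2 ^ n)]
  refine lintegral_congr_ae ?_
  filter_upwards [hX.start_zero] with ω h0
  simp only [h0, sub_zero, gridExit]
  congr 1
  rw [← Real.exp_nat_mul, ← Real.exp_sub]
  congr 2
  push_cast
  ring

/-- Optional stopping of the exponential martingale at the strict crossing time of `y`, capped at
`N`. The limit along the grids is justified by bounded second moments, which optional stopping
with the exponent `2 θ` provides; by absence of positive jumps the stopped path sits at `y`. -/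
lemma lintegral_exp_strictCrossingTime_min (hX : IsSpectrallyNegativeLevy X P) {θ y : ℝ}
    (hθ : 0 ≤ θ) (hy : 0 ≤ y) (N : ℕ) :
    ∫⁻ ω, (if strictCrossingTime (fun t => X t ω) y < N then
        ENNReal.ofReal (Real.exp (θ * y - laplaceExponent X P θ *
          (strictCrossingTime (fun t => X t ω) y).toReal))
      else ENNReal.ofReal (Real.exp (θ * X N ω - laplaceExponent X P θ * N))) ∂P = 1 := by
  set α := laplaceExponent X P θ with hα
  set κ := laplaceExponent X P (2 * θ) with hκ
  refine lintegral_eq_of_tendsto_of_sq_le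
    (g := fun n ω => ENNReal.ofReal (Real.exp (θ * X (gridExit (fun t => X t ω) y N n) ω -
      α * gridExit (fun t => X t ω) y N n)))
    (fun n => hX.toIsLevyProcess.measurable_exp_gridExit θ α y N n) ?_
    (C := ENNReal.ofReal (Real.exp (|κ - 2 * α| * N))) ENNReal.ofReal_ne_top (fun n => ?_)
    (fun n => hX.lintegral_exp_gridExit hθ y N n)
  · filter_upwards [hX.start_zero, hX.cadlag, hX.no_positive_jumps] with ω h0 hc hj
    split_ifs with hT
    · have h1 := hj.tendsto_apply_gridExit hc (y := y) (by simpa [h0] using hy) hT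
      have h2 := NNReal.tendsto_coe.2 (tendsto_gridExit hT).2
      exact (ENNReal.continuous_ofReal.tendsto _).comp ((Real.continuous_exp.tendsto _).comp
        ((h1.const_mul θ).sub (h2.const_mul α)))
    · simp_rw [gridExit_eq_of_le (not_lt.1 hT)]
      simp
  · calc _ ≤ ∫⁻ ω, ENNReal.ofReal (Real.exp (|κ - 2 * α| * N)) *
          ENNReal.ofReal (Real.exp (2 * θ * X (gridExit (fun t => X t ω) y N n) ω -
            κ * gridExit (fun t => X t ω) y N n)) ∂P := by
          refine lintegral_mono fun ω => ?_
          rw [← ENNReal.ofReal_pow (Real.exp_pos _).le, ← Real.exp_nat_mul,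
            ← ENNReal.ofReal_mul (Real.exp_pos _).le, ← Real.exp_add]
          refine ENNReal.ofReal_le_ofReal (Real.exp_le_exp.2 ?_)
          set σ := gridExit (fun t => X t ω) y N n
          have hσN : (σ : ℝ) ≤ N := by exact_mod_cast gridExit_le (fun t => X t ω) y N n
          have h1 : (κ - 2 * α) * σ ≤ |κ - 2 * α| * N :=
            mul_le_mul (le_abs_self _) hσN σ.coe_nonneg (abs_nonneg _)
          push_cast
          linarith
      _ = _ := by
          rw [lintegral_const_mul _
            (hX.toIsLevyProcess.measurable_exp_gridExit (2 * θ) κ y N n),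
            hX.lintegral_exp_gridExit (by positivity), mul_one]

end IsSpectrallyNegativeLevy

/-- The discount factor `exp (-q T)` of an extended time `T`, with value `0` at `T = ∞`. -/
noncomputable def discount (q : ℝ) (T : ℝ≥0∞) : ℝ≥0∞ :=
  if T < ∞ then ENNReal.ofReal (Real.exp (-q * T.toReal)) else 0

lemma measurable_discount (q : ℝ) : Measurable (discount q) :=
  Measurable.ite measurableSet_Iio (by fun_prop) measurable_const

lemma discount_antitone {q : ℝ} (hq : 0 ≤ q) : Antitone (discount q) := by
  intro S T hST
  unfold discount
  split_ifs with hT hS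
  · refine ENNReal.ofReal_le_ofReal (Real.exp_le_exp.2 ?_)
    have := ENNReal.toReal_mono hT.ne hST
    nlinarith
  · exact absurd (hST.trans_lt hT) hS
  all_goals exact zero_le

lemma discount_injective {q : ℝ} (hq : 0 < q) : Function.Injective (discount q) := by
  intro S T h
  have hpos : ∀ x : ℝ, ENNReal.ofReal (Real.exp x) ≠ 0 := fun x =>
    (ENNReal.ofReal_pos.2 (Real.exp_pos x)).ne'
  unfold discount at h
  split_ifs at h with hS hT hT
  · rw [ENNReal.ofReal_eq_ofReal_iff (Real.exp_pos _).le (Real.exp_pos _).le,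
      Real.exp_eq_exp] at h
    have h' : S.toReal = T.toReal := mul_left_cancel₀ (neg_ne_zero.2 hq.ne') h
    exact (ENNReal.toReal_eq_toReal_iff' hS.ne hT.ne).1 h'
  · exact absurd h (hpos _)
  · exact absurd h.symm (hpos _)
  · rw [not_lt_top_iff] at hS hT
    rw [hS, hT]

namespace IsSpectrallyNegativeLevy

/-- The transform of the strict crossing time. In the optional stopping identity at the capped time
`T ∧ N`, the contribution of `{N ≤ T}` decays geometrically in `N`: the path is below `y` there, so
the exponent `θ` may be replaced by `s₀`, for which the discounting at rate `α` dominates. -/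
lemma lintegral_discount_strictCrossingTime (hX : IsSpectrallyNegativeLevy X P) {θ s₀ α y : ℝ}
    (hs₀ : 0 ≤ s₀) (hsθ : s₀ ≤ θ) (hlt : laplaceExponent X P s₀ < α)
    (hα : laplaceExponent X P θ = α) (hy : 0 ≤ y) :
    ∫⁻ ω, discount α (strictCrossingTime (fun t => X t ω) y) ∂P =
      ENNReal.ofReal (Real.exp (-θ * y)) := by
  set T : Ω → ℝ≥0∞ := fun ω => strictCrossingTime (fun t => X t ω) y with hT
  have hTm : Measurable T := measurable_strictCrossingTime hX.measurable y
  -- The payoff `exp (θ y - α T)` on `{T < N}`.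
  set F : ℕ → Ω → ℝ≥0∞ := fun N ω =>
    if T ω < N then ENNReal.ofReal (Real.exp (θ * y)) * discount α (T ω) else 0 with hF
  have hFm : ∀ N, Measurable (F N) := fun N =>
    Measurable.ite (hTm measurableSet_Iio) ((measurable_discount α).comp hTm |>.const_mul _)
      measurable_const
  have hpay : ∀ (N : ℕ) ω, T ω < N → ENNReal.ofReal (Real.exp (θ * y - α * (T ω).toReal)) =
      ENNReal.ofReal (Real.exp (θ * y)) * discount α (T ω) := fun N ω h => by
    rw [discount, if_pos (h.trans (ENNReal.natCast_lt_top N)),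
      ← ENNReal.ofReal_mul (Real.exp_pos _).le, ← Real.exp_add]
    congr 2
    ring
  have hid : ∀ N : ℕ, ∫⁻ ω, (if T ω < N then ENNReal.ofReal (Real.exp (θ * y)) * discount α (T ω)
      else ENNReal.ofReal (Real.exp (θ * X N ω - α * N))) ∂P = 1 := fun N => by
    rw [← hX.lintegral_exp_strictCrossingTime_min (hs₀.trans hsθ) hy N, hα]
    refine lintegral_congr fun ω => ?_
    by_cases h : T ω < N
    · rw [if_pos h, if_pos h, hpay N ω h]
    · rw [if_neg h, if_neg h]
  have hlim : ∀ ω, Tendsto (fun N => F N ω) atTop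
      (𝓝 (ENNReal.ofReal (Real.exp (θ * y)) * discount α (T ω))) := by
    intro ω
    by_cases h : T ω < ∞
    · obtain ⟨M, hM⟩ := ENNReal.exists_nat_gt h.ne
      refine tendsto_const_nhds.congr' ?_
      filter_upwards [eventually_ge_atTop M] with N hN
      exact (if_pos (hM.trans_le (by exact_mod_cast hN))).symm
    · have : discount α (T ω) = 0 := if_neg h
      simp [hF, this]
  have hup : ∫⁻ ω, ENNReal.ofReal (Real.exp (θ * y)) * discount α (T ω) ∂P ≤ 1 := by
    have h := lintegral_liminf_le (μ := P) hFm (u := atTop)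
    rw [lintegral_congr fun ω => (hlim ω).liminf_eq] at h
    refine h.trans (liminf_le_of_le (by isBoundedDefault) fun b hb => ?_)
    obtain ⟨N, hN⟩ := hb.exists
    refine hN.trans ((lintegral_mono fun ω => ?_).trans (hid N).le)
    simp only [hF]
    split_ifs
    · exact le_rfl
    · exact zero_le
  have hlow : ∀ N : ℕ, 0 < N → 1 ≤ ∫⁻ ω, ENNReal.ofReal (Real.exp (θ * y)) * discount α (T ω) ∂P +
      ENNReal.ofReal (Real.exp ((θ - s₀) * y + (laplaceExponent X P s₀ - α) * N)) := by
    intro N hN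
    calc (1 : ℝ≥0∞) = _ := (hid N).symm
      _ ≤ ∫⁻ ω, (ENNReal.ofReal (Real.exp (θ * y)) * discount α (T ω) +
          ENNReal.ofReal (Real.exp ((θ - s₀) * y - α * N)) *
            ENNReal.ofReal (Real.exp (s₀ * X N ω))) ∂P := by
          refine lintegral_mono_ae ?_
          filter_upwards [hX.cadlag, hX.no_positive_jumps] with ω hc hj
          split_ifs with h
          · exact le_self_add
          · refine le_add_left ?_
            have hXN : X N ω ≤ y := by
              refine hj.le_of_forall_lt hc (t := N) (by exact_mod_cast hN) fun u hu => ?_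
              refine hc.le_of_lt_strictCrossingTime (lt_of_lt_of_le ?_ (not_lt.1 h))
              exact_mod_cast hu
            rw [← ENNReal.ofReal_mul (Real.exp_pos _).le, ← Real.exp_add]
            refine ENNReal.ofReal_le_ofReal (Real.exp_le_exp.2 ?_)
            nlinarith
      _ = _ := by
          have hm : Measurable fun ω => ENNReal.ofReal (Real.exp (s₀ * X N ω)) := by
            have := hX.measurable N
            fun_prop
          rw [lintegral_add_right _ (hm.const_mul _), lintegral_const_mul _ hm]
          have := hX.expMoment_natCast hs₀ N
          rw [expMoment] at this
          rw [this, ← ENNReal.ofReal_mul (Real.exp_pos _).le, ← Real.exp_add]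
          congr 3
          ring
  have hvanish : Tendsto (fun N : ℕ => ENNReal.ofReal (Real.exp ((θ - s₀) * y +
      (laplaceExponent X P s₀ - α) * N))) atTop (𝓝 0) := by
    rw [← ENNReal.ofReal_zero]
    refine (ENNReal.continuous_ofReal.tendsto _).comp (Real.tendsto_exp_atBot.comp ?_)
    exact tendsto_atBot_add_const_left _ _
      (tendsto_natCast_atTop_atTop.const_mul_atTop_of_neg (sub_neg.2 hlt))
  have hone : ∫⁻ ω, ENNReal.ofReal (Real.exp (θ * y)) * discount α (T ω) ∂P = 1 := by
    refine le_antisymm hup ?_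
    have := hvanish.const_add (∫⁻ ω, ENNReal.ofReal (Real.exp (θ * y)) * discount α (T ω) ∂P)
    rw [add_zero] at this
    exact ge_of_tendsto this ((eventually_gt_atTop 0).mono hlow)
  rw [lintegral_const_mul _ (show Measurable fun ω => discount α (T ω) from
    (measurable_discount α).comp hTm)] at hone
  calc _ = ENNReal.ofReal (Real.exp (-θ * y)) * (ENNReal.ofReal (Real.exp (θ * y)) *
        ∫⁻ ω, discount α (T ω) ∂P) := by
        rw [← mul_assoc, ← ENNReal.ofReal_mul (Real.exp_pos _).le, ← Real.exp_add]
        simp [hT]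
    _ = _ := by rw [hone, mul_one]

/-! ### From the strict crossing time to the first passage time -/

/-- Almost surely the first passage time of `[y, ∞)` is the strict crossing time of `y`: it is
squeezed between the strict crossing times of lower levels and that of `y`, whose transforms at a
large discount rate `q` agree in the limit. -/
lemma upCrossingTime_ae_eq (hX : IsSpectrallyNegativeLevy X P) {y : ℝ} (hy : 0 < y) :
    ∀ᵐ ω ∂P, upCrossingTime X y ω = strictCrossingTime (fun t => X t ω) y := by
  set q := max 0 (laplaceExponent X P 1) + 1 with hq
  have hq0 : 0 < q := by positivity
  have hq1 : laplaceExponent X P 1 < q := by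
    linarith [le_max_right 0 (laplaceExponent X P 1)]
  obtain ⟨hgr, hΦ⟩ := hX.isGreatest_rightInverse le_rfl hq1
  set Φ := rightInverse X P q
  have htr : ∀ {z : ℝ}, 0 ≤ z → ∫⁻ ω, discount q (strictCrossingTime (fun t => X t ω) z) ∂P =
      ENNReal.ofReal (Real.exp (-Φ * z)) := fun hz =>
    hX.lintegral_discount_strictCrossingTime zero_le_one hΦ.le hq1 hgr.1.2 hz
  set z : ℕ → ℝ := fun n => y - y * (1 / ((n : ℝ) + 1)) with hz
  have hz0 : ∀ n, 0 ≤ z n := fun n => by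
    have : 1 / ((n : ℝ) + 1) ≤ 1 := by
      rw [div_le_one (by positivity)]; linarith [(Nat.cast_nonneg n : (0 : ℝ) ≤ n)]
    simp only [hz]
    nlinarith
  have hzy : ∀ n, z n < y := fun n => by
    have : 0 < y * (1 / ((n : ℝ) + 1)) := by positivity
    simp only [hz]
    linarith
  have hzlim : Tendsto z atTop (𝓝 y) := by
    simpa [hz] using (tendsto_one_div_add_atTop_nhds_zero_nat.const_mul y).const_sub y
  set D : ℝ → Ω → ℝ≥0∞ := fun z ω => discount q (strictCrossingTime (fun t => X t ω) z) with hD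
  have hDm : ∀ z, Measurable (D z) := fun z =>
    (measurable_discount q).comp (measurable_strictCrossingTime hX.measurable z)
  have hsq : ∀ᵐ ω ∂P, D y ω ≤ discount q (upCrossingTime X y ω) ∧
      discount q (upCrossingTime X y ω) ≤ ⨅ n, D (z n) ω := by
    filter_upwards [hX.start_zero, hX.cadlag] with ω h0 hc
    exact ⟨discount_antitone hq0.le
        (upCrossingTime_le_strictCrossingTime (by rw [h0]; exact hy.le)),
      le_iInf fun n => discount_antitone hq0.le (strictCrossingTime_le_upCrossingTime hc (hzy n))⟩
  have hle : ∫⁻ ω, ⨅ n, D (z n) ω ∂P ≤ ∫⁻ ω, D y ω ∂P := by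
    have hlim : Tendsto (fun n => ENNReal.ofReal (Real.exp (-Φ * z n))) atTop
        (𝓝 (ENNReal.ofReal (Real.exp (-Φ * y)))) :=
      (ENNReal.continuous_ofReal.tendsto _).comp ((Real.continuous_exp.tendsto _).comp
        (hzlim.const_mul _))
    rw [htr hy.le]
    refine ge_of_tendsto' hlim fun n => ?_
    rw [← htr (hz0 n)]
    exact lintegral_mono fun ω => iInf_le _ n
  have heq : D y =ᵐ[P] fun ω => ⨅ n, D (z n) ω :=
    ae_eq_of_ae_le_of_lintegral_le (hsq.mono fun ω h => h.1.trans h.2)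
      (by rw [htr hy.le]; exact ENNReal.ofReal_ne_top)
      (Measurable.iInf fun n => hDm _).aemeasurable hle
  filter_upwards [hsq, heq] with ω h1 h2
  exact discount_injective hq0 (le_antisymm (h1.2.trans h2.ge) h1.1)

/-- The path enters `(0, ∞)` immediately: the transform of the strict crossing time of `0` has total
mass `1` at a positive discount rate. -/
lemma upCrossingTime_ae_eq_zero (hX : IsSpectrallyNegativeLevy X P) {y : ℝ} (hy : y ≤ 0) :
    ∀ᵐ ω ∂P, upCrossingTime X y ω = 0 := by
  set q := max 0 (laplaceExponent X P 1) + 1 with hq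
  have hq0 : 0 < q := by positivity
  have hq1 : laplaceExponent X P 1 < q := by
    linarith [le_max_right 0 (laplaceExponent X P 1)]
  obtain ⟨hgr, hΦ⟩ := hX.isGreatest_rightInverse le_rfl hq1
  have htr := hX.lintegral_discount_strictCrossingTime zero_le_one hΦ.le hq1 hgr.1.2 le_rfl
  rw [mul_zero, Real.exp_zero, ENNReal.ofReal_one] at htr
  have hd0 : discount q 0 = 1 := by simp [discount]
  have heq := ae_eq_of_ae_le_of_lintegral_le (μ := P)
    (f := fun ω => discount q (strictCrossingTime (fun t => X t ω) 0)) (g := fun _ => 1)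
    (ae_of_all _ fun ω => hd0 ▸ discount_antitone hq0.le zero_le) (by simp [htr])
    aemeasurable_const (by simp [htr])
  filter_upwards [heq, hX.start_zero] with ω hω h0
  have h1 : strictCrossingTime (fun t => X t ω) 0 = 0 :=
    discount_injective hq0 (hω.trans hd0.symm)
  exact le_antisymm ((upCrossingTime_mono X hy ω).trans
    ((upCrossingTime_le_strictCrossingTime h0.le).trans h1.le)) zero_le

end IsSpectrallyNegativeLevy

lemma ofReal_discountedCrossing {Ω : Type*} (X : ℝ≥0 → Ω → ℝ) (α y : ℝ) (ω : Ω) :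
    ENNReal.ofReal (discountedCrossing X α y ω) = discount α (upCrossingTime X y ω) := by
  by_cases h : upCrossingTime X y ω < ∞ <;> simp [discountedCrossing, discount, Set.indicator, h]

lemma discountedCrossing_eq_toReal {Ω : Type*} (X : ℝ≥0 → Ω → ℝ) (α y : ℝ) (ω : Ω) :
    discountedCrossing X α y ω = (discount α (upCrossingTime X y ω)).toReal := by
  rw [← ofReal_discountedCrossing, ENNReal.toReal_ofReal]
  exact Set.indicator_nonneg (fun _ _ => (Real.exp_pos _).le) _

end

theorem lemma1 {Ω : Type*} [MeasurableSpace Ω] (P : Measure Ω) [IsProbabilityMeasure P]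
    (X : ℝ≥0 → Ω → ℝ) (hX : IsSpectrallyNegativeLevy X P) (α : ℝ)
    (hα : laplaceExponent X P 1 < α ∨
      (laplaceExponent X P 1 = α ∧ α < 0 ∧ deriv (laplaceExponent X P) 1 < 0)) :
    IsGreatest {s : ℝ | 1 ≤ s ∧ laplaceExponent X P s = α} (rightInverse X P α) ∧
    ∀ y : ℝ, Integrable (discountedCrossing X α y) P ∧
      (0 < y → ∫ ω, discountedCrossing X α y ω ∂P = Real.exp (-rightInverse X P α * y)) ∧
      (y ≤ 0 → ∫ ω, discountedCrossing X α y ω ∂P = 1) := by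
  -- Both hypotheses put the Laplace exponent strictly below `α` somewhere on `[1, ∞)`.
  obtain ⟨s₀, h1, hs₀⟩ : ∃ s₀, 1 ≤ s₀ ∧ laplaceExponent X P s₀ < α := by
    rcases hα with h | ⟨h, -, hd⟩
    · exact ⟨1, le_rfl, h⟩
    · obtain ⟨s, hs, hlt⟩ := exists_lt_of_deriv_neg hd
      exact ⟨s, hs.le, h ▸ hlt⟩
  obtain ⟨hgr, hΦ⟩ := hX.isGreatest_rightInverse h1 hs₀
  refine ⟨hgr, fun y => ?_⟩
  rcases le_or_gt y 0 with hy | hy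
  · have hone : discountedCrossing X α y =ᵐ[P] fun _ => 1 := by
      filter_upwards [hX.upCrossingTime_ae_eq_zero hy] with ω hω
      simp [discountedCrossing_eq_toReal, hω, discount]
    refine ⟨(integrable_const 1).congr hone.symm, fun h => absurd hy (not_le.2 h), fun _ => ?_⟩
    rw [integral_congr_ae hone]
    simp
  · set D : Ω → ℝ≥0∞ := fun ω => discount α (strictCrossingTime (fun t => X t ω) y) with hD
    have hDm : Measurable D :=
      (measurable_discount α).comp (measurable_strictCrossingTime hX.measurable y)
    have htr : ∫⁻ ω, D ω ∂P = ENNReal.ofReal (Real.exp (-rightInverse X P α * y)) :=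
      hX.lintegral_discount_strictCrossingTime (zero_le_one.trans h1) hΦ.le hs₀ hgr.1.2 hy.le
    have heq : discountedCrossing X α y =ᵐ[P] fun ω => (D ω).toReal := by
      filter_upwards [hX.upCrossingTime_ae_eq hy] with ω hω
      rw [discountedCrossing_eq_toReal, hω]
    have hfin : ∫⁻ ω, D ω ∂P ≠ ∞ := htr ▸ ENNReal.ofReal_ne_top
    refine ⟨(integrable_toReal_of_lintegral_ne_top hDm.aemeasurable hfin).congr heq.symm,
      fun _ => ?_, fun h => absurd hy (not_lt.2 h)⟩
    rw [integral_congr_ae heq, integral_toReal hDm.aemeasurable (ae_lt_top hDm hfin), htr,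
      ENNReal.toReal_ofReal (Real.exp_pos _).le]
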